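/- Let $F$ be a finite field of characteristic $2$ with $F\neq\mathbb F_2$, and let $R$ be a complete local $W(F)$-algebra that is a filtered inverse limit of local Artin $W(F)$-algebras with residue field $F$, with its inverse limit topology. Here $W(F)$ is the ring of Witt vectors of $F$. Let $\mathfrak m_R$ be the maximal ideal of $R$, and suppose that $\dim_F \mathfrak m_R/\mathfrak m_R^2=1$. If $F\cong\mathbb F_4$, suppose in addition that $2\in\mathfrak m_R^2$. Then every closed subgroup $H\subset \mathrm{SL}_2(R)$ whose image under reduction is all of $\mathrm{SL}_2(R/(2,\mathfrak m_R^2))$ equals $\mathrm{SL}_2(R)$. -/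

import Mathlib

open scoped Matrix

/-- Let `F` be a field of characteristic `p` and `R` a local ring with a `W(F)`-algebra structure
and a uniform structure.  `IsProArtinLocal p F R` says that `R` is a complete local `W(F)`-algebra that is
a filtered inverse limit of local Artin `W(F)`-algebras with residue field `F`, with the
inverse limit topology of the discrete topologies: the structure map
`W(F) → R` induces a surjection of `W(F)` onto the residue field of `R` (its kernel is then the
maximal ideal of `W(F)`, so that the residue field is `F`), `R` is a complete
Hausdorff topological ring in which the open ideals are a basis of neighbourhoods of zero
(so that `R` is the inverse limit of the rings `R ⧸ I`, `I` an open ideal), and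
all these quotients are Artinian. -/
class IsProArtinLocal (p : ℕ) [Fact p.Prime] (F : Type*) [Field F] [CharP F p]
    (R : Type*) [CommRing R] [IsLocalRing R] [Algebra (WittVector p F) R] [UniformSpace R] :
    Prop where
  residue_surjective : Function.Surjective
    ((IsLocalRing.residue R).comp (algebraMap (WittVector p F) R))
  isUniformAddGroup : IsUniformAddGroup R
  isTopologicalRing : IsTopologicalRing R
  isLinearTopology : IsLinearTopology R R
  t2Space : T2Space R
  completeSpace : CompleteSpace R
  isArtinianRing_quotient : ∀ I : Ideal R, IsOpen (I : Set R) → IsArtinianRing (R ⧸ I)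

namespace SL2Lift

open Matrix IsLocalRing

section

variable {A k : Type*} [CommRing A] [Field k]

/-! Since `H` is closed, it is enough to fill `SL₂` of each quotient `A` of `R` by an open ideal.
There the maximal ideal is nilpotent and, by Nakayama, generated by one element `x`: take `x = 2` if
`2 ∉ 𝔪²`, and otherwise any `x ∈ 𝔪 \ 𝔪²`.

One climbs the powers of `x` (`SurjMod.succ`). The `n`th layer, the reductions of those `M` with `1
+ xⁿM ∈ H`, is an additive group of matrices over the residue field `k`, stable under conjugation by
`SL₂`, and of trace zero if `xⁿ ≠ 0`. In characteristic 2 the scalars are a proper stable subgroup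
of the trace-zero matrices, but for `|k| > 2` a single nonscalar element generates everything
(`mem_of_trace_eq_zero`).

So each layer needs only one nonscalar element. If `2 ∈ (x²)`, commutators supply it for `n ≥ 2`. If
`x = 2`, squares of lifted unipotents do for `n ≥ 2`; for `n = 1` a layer of scalars would make
inversion on `k` additive, which forces `|k| ≤ 4`. -/

lemma coe_mul (g h : SpecialLinearGroup (Fin 2) A) : (g * h).1 = g.1 * h.1 := rfl

lemma coe_one : (1 : SpecialLinearGroup (Fin 2) A).1 = 1 := rfl

lemma coe_inv (g : SpecialLinearGroup (Fin 2) A) :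
    (g⁻¹).1 = !![g.1 1 1, -g.1 0 1; -g.1 1 0, g.1 0 0] := adjugate_fin_two g.1

/-- The upper unipotent matrix with off-diagonal entry `t`. -/
def upper (t : A) : SpecialLinearGroup (Fin 2) A := ⟨!![1, t; 0, 1], by simp⟩

/-- The diagonal matrix with entries `s` and its inverse `s'`. -/
def torus (s s' : A) (h : s * s' = 1) : SpecialLinearGroup (Fin 2) A :=
  ⟨!![s, 0; 0, s'], by simp [h]⟩

/-- The matrix that exchanges the coordinates, up to sign. -/
def weyl : SpecialLinearGroup (Fin 2) A := ⟨!![0, 1; -1, 0], by simp⟩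

lemma coe_upper (t : A) : (upper t).1 = !![1, t; 0, 1] := rfl

lemma coe_torus (s s' : A) (h : s * s' = 1) : (torus s s' h).1 = !![s, 0; 0, s'] := rfl

lemma coe_weyl : (weyl : SpecialLinearGroup (Fin 2) A).1 = !![0, 1; -1, 0] := rfl

/-- `SurjMod H J` says that every element of `SL₂` is congruent modulo `J` to one of `H`. -/
def SurjMod (H : Subgroup (SpecialLinearGroup (Fin 2) A)) (J : Ideal A) : Prop :=
  ∀ g : SpecialLinearGroup (Fin 2) A, ∃ h ∈ H, ∀ i j, h.1 i j - g.1 i j ∈ J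

lemma SurjMod.mono {H : Subgroup (SpecialLinearGroup (Fin 2) A)} {J J' : Ideal A}
    (h : SurjMod H J) (hJ : J ≤ J') : SurjMod H J' := fun g ↦
  let ⟨a, ha, hag⟩ := h g
  ⟨a, ha, fun i j ↦ hJ (hag i j)⟩

lemma SurjMod.exists_eq_add {H : Subgroup (SpecialLinearGroup (Fin 2) A)} {y : A}
    (h : SurjMod H (Ideal.span {y})) (g : SpecialLinearGroup (Fin 2) A) :
    ∃ a ∈ H, ∃ M : Matrix (Fin 2) (Fin 2) A, a.1 = g.1 + y • M := by
  obtain ⟨a, ha, hag⟩ := h g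
  simp only [Ideal.mem_span_singleton] at hag
  choose M hM using hag
  refine ⟨a, ha, Matrix.of M, ?_⟩
  ext i j
  simp [← hM]

/-! ### Trace-zero matrices in characteristic 2 -/

/-- An additive group of `2 × 2` matrices over a finite field of characteristic `2` with more
than two elements that is stable under conjugation by the image of `SL₂(A)` and contains a
nonscalar matrix of trace zero contains all matrices of trace zero. -/
lemma mem_of_trace_eq_zero [Finite k] [CharP k 2] {φ : A →+* k} (hφ : Function.Surjective φ)
    [IsLocalHom φ] {s : k} (hs0 : s ≠ 0) (hs1 : s ≠ 1)
    (W : AddSubgroup (Matrix (Fin 2) (Fin 2) k))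
    (hW : ∀ g : SpecialLinearGroup (Fin 2) A, ∀ B ∈ W,
      g.1.map φ * B * (g⁻¹).1.map φ ∈ W)
    {B : Matrix (Fin 2) (Fin 2) k} (hB : B ∈ W) (htr : B.trace = 0)
    (hne : B 0 1 ≠ 0 ∨ B 1 0 ≠ 0) {C : Matrix (Fin 2) (Fin 2) k} (hC : C.trace = 0) : C ∈ W := by
  have h2 : (2 : k) = 0 := CharTwo.two_eq_zero
  have hsw : ∀ a b c d : k, !![a, b; c, d] ∈ W → !![d, c; b, a] ∈ W := by
    intro a b c d h
    convert hW weyl _ h using 1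
    rw [coe_inv, coe_weyl]
    ext i j
    fin_cases i <;> fin_cases j <;>
      simp [Matrix.mul_apply, Fin.sum_univ_two, CharTwo.neg_eq]
  have htor : ∀ t : k, t ≠ 0 → ∀ a b c d : k, !![a, b; c, d] ∈ W →
      !![a, t ^ 2 * b; t⁻¹ ^ 2 * c, d] ∈ W := by
    intro t ht a b c d h
    obtain ⟨u, rfl⟩ := hφ t
    obtain ⟨v, hv⟩ := (isUnit_of_map_unit φ u (isUnit_iff_ne_zero.2 ht)).exists_right_inv
    have hv' : φ v = (φ u)⁻¹ := eq_inv_of_mul_eq_one_right (by rw [← map_mul, hv, map_one])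
    convert hW (torus u v hv) _ h using 1
    rw [coe_inv, coe_torus]
    ext i j
    fin_cases i <;> fin_cases j <;>
      simp [Matrix.mul_apply, Fin.sum_univ_two, hv'] <;> field_simp
  have hup : ∀ a b c t : k, !![a, b; c, a] ∈ W → !![t * c, t ^ 2 * c; 0, t * c] ∈ W := by
    intro a b c t h
    obtain ⟨u, rfl⟩ := hφ t
    convert W.sub_mem (hW (upper u) _ h) h using 1
    rw [coe_inv, coe_upper]
    ext i j
    fin_cases i <;> fin_cases j <;>
      simp [Matrix.mul_apply,
      Fin.sum_univ_two] <;> grind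
  have hBeq : ∀ B : Matrix (Fin 2) (Fin 2) k, B.trace = 0 → B = !![B 0 0, B 0 1; B 1 0, B 0 0] := by
    intro B hB
    rw [trace_fin_two] at hB
    ext i j
    fin_cases i <;> fin_cases j <;> simp
    grind
  obtain ⟨a, b, c, hc, h⟩ : ∃ a b c : k, c ≠ 0 ∧ !![a, b; c, a] ∈ W := by
    rw [hBeq B htr] at hB
    rcases hne with h | h
    · exact ⟨_, _, _, h, hsw _ _ _ _ hB⟩
    · exact ⟨_, _, _, h, hB⟩
  have hscalar : ∀ z : k, !![z, 0; 0, z] ∈ W := by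
    intro z
    have hs : 1 - s ≠ 0 := sub_ne_zero.2 hs1.symm
    set t := z / (c * (1 - s)) with ht
    -- Both matrices have upper right entry `s²t²c`, but their diagonals are `tc` and `stc`, so the
    -- difference is a scalar.
    convert W.sub_mem (htor s hs0 _ _ _ _ (hup a b c t h)) (hup a b c (s * t) h) using 1
    have hz : z = t * c - s * t * c := by
      rw [ht]; field_simp
    ext i j
    fin_cases i <;> fin_cases j <;> simp <;> grind
  have hE : ∀ z : k, !![0, z; 0, 0] ∈ W := by
    intro z
    -- Squaring is onto in `k`, so `t²c` takes every value.
    obtain ⟨t, ht⟩ := FiniteField.isSquare_of_char_two (ringChar.eq k 2 ▸ rfl) (z / c)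
    convert W.sub_mem (hup a b c t h) (hscalar (t * c)) using 1
    have hz : z = t * t * c := by rw [← ht]; field_simp
    ext i j
    fin_cases i <;> fin_cases j <;> simp; grind
  rw [hBeq C hC]
  convert W.add_mem (W.add_mem (hscalar (C 0 0)) (hE (C 0 1))) (hsw _ _ _ _ (hE (C 1 0))) using 1
  ext i j
  fin_cases i <;> fin_cases j <;> simp

/-! ### Layers and the inductive step -/

lemma map_eq_map {φ : A →+* k} {x : A} (hx : φ x = 0)
    {h g : SpecialLinearGroup (Fin 2) A} {M : Matrix (Fin 2) (Fin 2) A}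
    (e : h.1 = g.1 + x • M) : h.1.map φ = g.1.map φ := by
  ext i j
  simp [e, hx]

lemma coe_mul_coe_inv (g : SpecialLinearGroup (Fin 2) A) : g.1 * (g⁻¹).1 = 1 := by
  rw [← coe_mul, mul_inv_cancel, coe_one]

lemma map_inv_eq_map_inv {φ : A →+* k} {h g : SpecialLinearGroup (Fin 2) A}
    (e : h.1.map φ = g.1.map φ) : (h⁻¹).1.map φ = (g⁻¹).1.map φ := by
  rw [coe_inv, coe_inv]
  ext i j
  have := fun i j ↦ congrFun (congrFun e i) j
  simp only [map_apply] at this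
  fin_cases i <;> fin_cases j <;>
    simp [this]

lemma det_one_add_smul (y : A) (M : Matrix (Fin 2) (Fin 2) A) :
    (1 + y • M).det = 1 + y * (M.trace + y * M.det) := by
  simp [det_fin_two, trace_fin_two]
  ring

/-- A nonzero reduced trace would make `tr M + xⁿ det M` a unit, while the determinant condition
says that `xⁿ` times it vanishes. -/
lemma trace_map_eq_zero {φ : A →+* k} [IsLocalHom φ] {x : A} (hx : φ x = 0)
    {n : ℕ} (hn : n ≠ 0) (hxn : x ^ n ≠ 0)
    {h : SpecialLinearGroup (Fin 2) A} {M : Matrix (Fin 2) (Fin 2) A}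
    (hM : h.1 = 1 + x ^ n • M) : (M.map φ).trace = 0 := by
  by_contra hne
  have hdet := h.2
  rw [hM, det_one_add_smul] at hdet
  have hu : IsUnit (M.trace + x ^ n * M.det) := by
    refine isUnit_of_map_unit φ _ (isUnit_iff_ne_zero.2 ?_)
    simpa [hx, hn, trace_fin_two] using hne
  exact hxn (hu.mul_left_eq_zero.1 (by simpa using hdet))

/-- The reductions of the matrices `M` for which `1 + x ^ n M` lies in `H`. -/
def layer [CharP k 2] (φ : A →+* k) (H : Subgroup (SpecialLinearGroup (Fin 2) A)) {x : A}
    (hx : φ x = 0) {n : ℕ} (hn : n ≠ 0) : AddSubgroup (Matrix (Fin 2) (Fin 2) k) where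
  carrier := {B | ∃ h ∈ H, ∃ M : Matrix (Fin 2) (Fin 2) A, h.1 = 1 + x ^ n • M ∧ M.map φ = B}
  zero_mem' := ⟨1, H.one_mem, 0, by simp, by ext; simp⟩
  add_mem' := by
    rintro _ _ ⟨h, hh, M, hM, rfl⟩ ⟨h', hh', M', hM', rfl⟩
    refine ⟨h * h', H.mul_mem hh hh', M + M' + x ^ n • (M * M'), ?_, ?_⟩
    · rw [coe_mul, hM, hM']
      simp only [mul_add, add_mul, one_mul, mul_one, smul_add, Matrix.smul_mul, Matrix.mul_smul,
        smul_smul]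
      abel
    · ext i j
      simp [hx, hn]
  neg_mem' := by
    rintro B ⟨h, hh, M, hM, rfl⟩
    refine ⟨h, hh, M, hM, ?_⟩
    ext i j
    simp [CharTwo.neg_eq]

section

variable [CharP k 2] {φ : A →+* k} {H : Subgroup (SpecialLinearGroup (Fin 2) A)} {x : A}
  (hx : φ x = 0) {n : ℕ} (hn : n ≠ 0)

lemma commutator_mem_layer {h g : SpecialLinearGroup (Fin 2) A} (hh : h ∈ H) (hg : g ∈ H)
    {N : Matrix (Fin 2) (Fin 2) A} (e : g.1 * h.1 - h.1 * g.1 = x ^ n • N) :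
    N.map φ * ((h * g)⁻¹).1.map φ ∈ layer φ H hx hn := by
  refine ⟨g * h * (h * g)⁻¹, H.mul_mem (H.mul_mem hg hh) (H.inv_mem (H.mul_mem hh hg)),
    N * ((h * g)⁻¹).1, ?_, by rw [Matrix.map_mul]⟩
  rw [← Matrix.smul_mul, ← e, sub_mul, coe_mul, coe_mul,
    ← coe_mul h g, coe_mul_coe_inv]
  abel

lemma conj_mem_layer (hsurj : SurjMod H (Ideal.span {x})) (g : SpecialLinearGroup (Fin 2) A)
    (B : Matrix (Fin 2) (Fin 2) k) (hB : B ∈ layer φ H hx hn) :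
    g.1.map φ * B * (g⁻¹).1.map φ ∈ layer φ H hx hn := by
  obtain ⟨h, hh, M, hM, rfl⟩ := hB
  obtain ⟨a, ha, C, hC⟩ := hsurj.exists_eq_add g
  have e := map_eq_map hx hC
  rw [← e, ← map_inv_eq_map_inv e, ← Matrix.map_mul, ← Matrix.map_mul]
  refine ⟨a * h * a⁻¹, H.mul_mem (H.mul_mem ha hh) (H.inv_mem ha), _, ?_, rfl⟩
  rw [coe_mul, coe_mul, hM]
  rw [mul_add, add_mul, mul_one, coe_mul_coe_inv]
  simp only [Matrix.smul_mul, Matrix.mul_smul]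

/-- The inductive step: `H` is onto modulo `x ^ (n + 1)` if it is onto modulo `x ^ n` and its
`n`th layer has a nonscalar element. -/
lemma SurjMod.succ [Finite k] [IsLocalHom φ] (hφ : Function.Surjective φ)
    (hker : RingHom.ker φ = Ideal.span {x}) {s : k} (hs0 : s ≠ 0) (hs1 : s ≠ 1)
    (hsurj : SurjMod H (Ideal.span {x ^ n}))
    (hlayer : x ^ n ≠ 0 → ∃ B ∈ layer φ H hx hn, B 0 1 ≠ 0 ∨ B 1 0 ≠ 0) :
    SurjMod H (Ideal.span {x ^ (n + 1)}) := by
  -- If `xⁿ = 0`, the trace argument is unavailable, but both ideals are zero.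
  by_cases hxn : x ^ n = 0
  · rwa [pow_succ, hxn, zero_mul, ← hxn]
  obtain ⟨B, hB, hne⟩ := hlayer hxn
  have hsurj1 : SurjMod H (Ideal.span {x}) :=
    hsurj.mono (Ideal.span_singleton_le_span_singleton.2 (dvd_pow_self x hn))
  have htr : B.trace = 0 := by
    obtain ⟨h, hh, M, hM, rfl⟩ := hB
    exact trace_map_eq_zero hx hn hxn hM
  intro g
  obtain ⟨a, ha, M, hM⟩ := hsurj.exists_eq_add g
  have hag : (a⁻¹ * g).1 = 1 + x ^ n • (-((a⁻¹).1 * M)) := by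
    rw [coe_mul, eq_sub_of_add_eq hM.symm, mul_sub,
      ← coe_mul, inv_mul_cancel]
    simp [sub_eq_add_neg]
  obtain ⟨b, hb, N, hN, hNM⟩ := mem_of_trace_eq_zero hφ hs0 hs1 (layer φ H hx hn)
    (conj_mem_layer hx hn hsurj1) hB htr hne (trace_map_eq_zero hx hn hxn hag)
  refine ⟨a * b, H.mul_mem ha hb, ?_⟩
  set M' := -((a⁻¹).1 * M)
  have hg : g.1 = a.1 * (1 + x ^ n • M') := by
    rw [← hag, ← coe_mul, mul_inv_cancel_left]
  have hd : ∀ i j, N i j - M' i j ∈ Ideal.span {x} := by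
    intro i j
    rw [← hker, RingHom.mem_ker, map_sub, sub_eq_zero]
    exact congrFun (congrFun hNM i) j
  have hab : (a * b).1 - g.1 = x ^ n • (a.1 * (N - M')) := by
    rw [coe_mul, hg, hN, mul_add, mul_add, mul_sub]
    simp [smul_sub]
  intro i j
  rw [← Matrix.sub_apply, hab, Matrix.smul_apply, smul_eq_mul, pow_succ,
    ← Ideal.span_singleton_mul_span_singleton,
    Matrix.mul_apply]
  exact Ideal.mul_mem_mul (Ideal.mem_span_singleton_self _)
    (Ideal.sum_mem _ fun l _ ↦ Ideal.mul_mem_left _ _ (hd l j))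

end

/-! ### Nonscalar elements when 2 lies in (x²) -/

lemma exists_one_add_mul_eq_one {φ : A →+* k} [IsLocalHom φ] {x : A} (hx : φ x = 0) :
    ∃ v, (1 + x) * v = 1 :=
  (isUnit_of_map_unit φ (1 + x) (by simp [hx])).exists_right_inv

section

variable [CharP k 2] {φ : A →+* k} {H : Subgroup (SpecialLinearGroup (Fin 2) A)} {x : A}
  (hx : φ x = 0) {n : ℕ} (hn : n ≠ 0)

lemma sub_mul_inv_mem_layer {h g : SpecialLinearGroup (Fin 2) A} (hh : h ∈ H) (hg : g ∈ H)
    (h1 : h.1.map φ = 1) {N : Matrix (Fin 2) (Fin 2) A}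
    (e : g.1 * h.1 - h.1 * g.1 = x ^ n • N) :
    N.map φ * (g⁻¹).1.map φ ∈ layer φ H hx hn := by
  have hm : (h * g).1.map φ = g.1.map φ := by rw [coe_mul, Matrix.map_mul, h1, one_mul]
  rw [← map_inv_eq_map_inv hm]
  exact commutator_mem_layer hx hn hh hg e

/-- Commute lifts of `upper (x ^ (m + 1))` and `diag(1 + x, (1 + x)⁻¹)`. As `(1 + x)² - 1 = x²(1 +
xδ)`, the main term is a unit times `x ^ (m + 3)` in the upper right corner. Both matrices are `1`
modulo `x`, so the lifting errors enter one power of `x` higher. -/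
lemma exists_nonscalar_of_three_le [IsLocalHom φ] {δ : A} (h2 : (2 : A) = x ^ 2 * δ) {m : ℕ}
    (hsurj : SurjMod H (Ideal.span {x ^ (m + 3)})) :
    ∃ B ∈ layer φ H hx (Nat.succ_ne_zero (m + 2)), B 0 1 ≠ 0 ∨ B 1 0 ≠ 0 := by
  obtain ⟨v, hv⟩ := exists_one_add_mul_eq_one hx
  obtain ⟨h, hh, M, hM⟩ := hsurj.exists_eq_add (upper (x ^ (m + 1)))
  obtain ⟨g, hg, M', hM'⟩ := hsurj.exists_eq_add (torus (1 + x) v hv)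
  rw [coe_upper] at hM
  rw [coe_torus] at hM'
  have hφv : φ v = 1 := by simpa [hx] using congrArg φ hv
  have h1 : h.1.map φ = 1 := by
    rw [hM]
    ext i j
    fin_cases i <;> fin_cases j <;> simp [hx]
  have g1 : g.1.map φ = 1 := by
    rw [hM']
    ext i j
    fin_cases i <;> fin_cases j <;> simp [hx, hφv]
  have e : g.1 * h.1 - h.1 * g.1 = x ^ (m + 3) • (!![0, (1 + x * δ) * v; 0, 0] + x • (
      !![1, 0; 0, -v] * M - M * !![1, 0; 0, -v] +
      x ^ m • (M' * !![0, 1; 0, 0] - !![0, 1; 0, 0] * M') +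
      x ^ (m + 2) • (M' * M - M * M'))) := by
    rw [hM, hM']
    ext i j
    simp only [Matrix.add_apply, Matrix.sub_apply, Matrix.smul_apply, Matrix.mul_apply,
      Fin.sum_univ_two]
    fin_cases i <;> fin_cases j <;> simp <;> grind
  have := sub_mul_inv_mem_layer hx (Nat.succ_ne_zero (m + 2)) hh hg h1 e
  rw [map_inv_eq_map_inv (g := 1) (by rw [g1, coe_one]; ext i j; simp [one_apply, apply_ite φ]),
    inv_one, coe_one, ← Matrix.map_mul, mul_one] at this
  refine ⟨_, this, Or.inl ?_⟩
  simp only [map_apply, Matrix.add_apply, Matrix.sub_apply, Matrix.smul_apply, Matrix.mul_apply,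
      Fin.sum_univ_two]
  simp [hx, hφv]

/-- A lift of `diag(1 + x, (1 + x)⁻¹)` is the scalar `1 + x` plus `x²N`, and determinant 1 gives `N`
reduced trace 1. Commutators put `gNg⁻¹ - N` in the layer. If these were all scalar, `g = upper 1`
would give `r = 1` for the lower left entry of `N`, and a torus element `r = 0`. -/
lemma exists_nonscalar_of_eq_two [IsLocalHom φ] (hφ : Function.Surjective φ) {s : k}
    (hs0 : s ≠ 0) (hs1 : s ≠ 1) {δ : A} (h2 : (2 : A) = x ^ 2 * δ)
    (hsurj : SurjMod H (Ideal.span {x ^ 2})) (hx2 : x ^ 2 ≠ 0) :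
    ∃ B ∈ layer φ H hx two_ne_zero, B 0 1 ≠ 0 ∨ B 1 0 ≠ 0 := by
  obtain ⟨v, hv⟩ := exists_one_add_mul_eq_one hx
  obtain ⟨h, hh, M, hM⟩ := hsurj.exists_eq_add (torus (1 + x) v hv)
  rw [coe_torus] at hM
  have hφv : φ v = 1 := by simpa [hx] using congrArg φ hv
  obtain ⟨p, q, r, t, hB⟩ : ∃ p q r t : A,
      h.1 = !![1 + x + x ^ 2 * p, x ^ 2 * q; x ^ 2 * r, 1 + x + x ^ 2 * t] := by
    -- Here `v = 1 - x + x²v = 1 + x + x²(v - xδ)`, using `2 = x²δ`.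
    refine ⟨M 0 0, M 0 1, M 1 0, M 1 1 + (v - x * δ), ?_⟩
    rw [hM]
    ext i j
    fin_cases i <;> fin_cases j <;> simp
    grind
  have h1 : h.1.map φ = 1 := by
    rw [hB]
    ext i j
    fin_cases i <;> fin_cases j <;> simp [hx]
  have htr : φ p + φ t + 1 = 0 := by
    by_contra hne
    have hdet := h.2
    rw [hB, det_fin_two_of] at hdet
    have hu : IsUnit (x * δ + 1 + (1 + x) * (p + t) + x ^ 2 * (p * t - q * r)) := by
      refine isUnit_of_map_unit φ _ (isUnit_iff_ne_zero.2 ?_)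
      simpa [hx, add_comm, add_left_comm, add_assoc] using hne
    refine hx2 (hu.mul_left_eq_zero.1 ?_)
    linear_combination hdet - x * h2
  have key : ∀ g : SpecialLinearGroup (Fin 2) A,
      (g.1 * !![p, q; r, t] - !![p, q; r, t] * g.1).map φ * (g⁻¹).1.map φ ∈
        layer φ H hx two_ne_zero := by
    intro g
    obtain ⟨a, ha, C, hC⟩ := hsurj.exists_eq_add g
    have hag : a.1.map φ = g.1.map φ := by
      rw [hC]
      ext i j
      simp [hx]
    have e : a.1 * h.1 - h.1 * a.1 =
        x ^ 2 • (a.1 * !![p, q; r, t] - !![p, q; r, t] * a.1) := by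
      rw [hB]
      ext i j
      simp only [Matrix.sub_apply, Matrix.smul_apply, Matrix.mul_apply,
      Fin.sum_univ_two]
      fin_cases i <;> fin_cases j <;> simp <;> ring
    have := sub_mul_inv_mem_layer hx two_ne_zero hh ha h1 e
    rwa [map_inv_eq_map_inv hag, Matrix.map_sub _ (map_sub φ), Matrix.map_mul, Matrix.map_mul, hag,
      ← Matrix.map_mul, ← Matrix.map_mul, ← Matrix.map_sub _ (map_sub φ)] at this
  by_contra! hall
  have hk2 : (2 : k) = 0 := CharTwo.two_eq_zero
  have hup := (hall _ (key (upper 1))).1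
  obtain ⟨u, rfl⟩ := hφ s
  obtain ⟨w, hw⟩ := (isUnit_of_map_unit φ u (isUnit_iff_ne_zero.2 hs0)).exists_right_inv
  have htor := (hall _ (key (torus u w hw))).1
  have hφw : φ u * φ w = 1 := by rw [← map_mul, hw, map_one]
  have hlow := (hall _ (key (torus u w hw))).2
  rw [coe_inv, coe_upper] at hup
  rw [coe_inv, coe_torus] at htor hlow
  simp only [map_apply, Matrix.sub_apply, Matrix.mul_apply,
      Fin.sum_univ_two] at hup htor hlow
  simp at hup htor hlow
  have hsq : (φ u - 1) ^ 2 ≠ 0 := pow_ne_zero 2 (sub_ne_zero.2 hs1)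
  have hr : φ r = 0 := by
    refine (mul_eq_zero.1 (?_ : (φ u - 1) ^ 2 * φ r = 0)).resolve_left hsq
    grind
  grind

end

/-! ### Nonscalar elements when x = 2 -/

section

variable [CharP k 2] {φ : A →+* k} {H : Subgroup (SpecialLinearGroup (Fin 2) A)}
  (hx : φ 2 = 0)

/-- Squaring a lift of `upper (2 ^ (m + 1))` doubles its off-diagonal entry, and every error is
divisible by `2 ^ (m + 3)`. -/
lemma exists_nonscalar_of_two_le {m : ℕ} (hsurj : SurjMod H (Ideal.span {2 ^ (m + 2)})) :
    ∃ B ∈ layer φ H hx (Nat.succ_ne_zero (m + 1)), B 0 1 ≠ 0 ∨ B 1 0 ≠ 0 := by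
  obtain ⟨h, hh, M, hM⟩ := hsurj.exists_eq_add (upper (2 ^ (m + 1)))
  rw [coe_upper] at hM
  refine ⟨_, ⟨h * h, H.mul_mem hh hh, !![0, 1; 0, 0] + (2 : A) • (M +
    (2 : A) ^ m • (!![0, 1; 0, 0] * M + M * !![0, 1; 0, 0]) + (2 : A) ^ (m + 1) • (M * M)),
    ?_, rfl⟩, Or.inl ?_⟩
  · rw [coe_mul, hM]
    ext i j
    simp only [Matrix.add_apply, Matrix.smul_apply, Matrix.mul_apply,
      Fin.sum_univ_two]
    fin_cases i <;> fin_cases j <;> simp <;> ring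
  · simp only [map_apply, Matrix.add_apply, Matrix.smul_apply, Matrix.mul_apply,
      Fin.sum_univ_two]
    simp [hx]

/-- Let `h t = upper t + 2 M t` lie in `H` and suppose the layer is scalar. Comparing `h t * h u`
with `h (t + u)` shows that the reduced lower left entry of `M t` is additive in `t`; the square of
`h t` together with its determinant shows that it is `t⁻¹`. -/
lemma exists_nonscalar_of_eq_one [IsLocalHom φ] (hφ : Function.Surjective φ) {s : k}
    (hs0 : s ≠ 0) (hs1 : s ≠ 1) (hs : s ^ 2 + s + 1 ≠ 0)
    (hsurj : SurjMod H (Ideal.span {2})) (h2 : (2 : A) ≠ 0) :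
    ∃ B ∈ layer φ H hx one_ne_zero, B 0 1 ≠ 0 ∨ B 1 0 ≠ 0 := by
  have hk2 : (2 : k) = 0 := CharTwo.two_eq_zero
  by_contra! hall
  choose h hh M hM using fun t : A ↦ hsurj.exists_eq_add (upper t)
  simp only [coe_upper] at hM
  have hadd : ∀ t u, φ (M (t + u) 1 0) = φ (M t 1 0) + φ (M u 1 0) := by
    intro t u
    have e : (h t * h u).1 = (h (t + u)).1 + (2 : A) • (!![1, t; 0, 1] * M u + M t * !![1, u; 0, 1] +
        (2 : A) • (M t * M u) - M (t + u)) := by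
      rw [coe_mul, hM, hM, hM]
      ext i j
      simp only [Matrix.add_apply, Matrix.sub_apply, Matrix.smul_apply, Matrix.mul_apply,
      Fin.sum_univ_two]
      fin_cases i <;> fin_cases j <;> simp <;> ring
    set Q := !![1, t; 0, 1] * M u + M t * !![1, u; 0, 1] + (2 : A) • (M t * M u) - M (t + u) with hQ
    have hmem : (((h (t + u))⁻¹).1 * Q).map φ ∈ layer φ H hx one_ne_zero := by
      refine ⟨(h (t + u))⁻¹ * (h t * h u), H.mul_mem (H.inv_mem (hh _)) (H.mul_mem (hh _) (hh _)),
        _, ?_, rfl⟩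
      rw [coe_mul, e, mul_add, ← coe_mul, inv_mul_cancel, coe_one, pow_one, Matrix.mul_smul]
    have := (hall _ hmem).2
    rw [coe_inv, hM] at this
    simp only [hQ, map_apply, Matrix.add_apply, Matrix.sub_apply, Matrix.smul_apply, Matrix.mul_apply,
      Fin.sum_univ_two] at this
    simp [hx] at this
    grind
  have hmul : ∀ t, φ t ≠ 0 → φ t * φ (M t 1 0) = 1 := by
    intro t ht
    have hmem : (!![0, t; 0, 0] + !![1, t; 0, 1] * M t + M t * !![1, t; 0, 1] +
        (2 : A) • (M t * M t)).map φ ∈ layer φ H hx one_ne_zero := by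
      refine ⟨h t * h t, H.mul_mem (hh _) (hh _), _, ?_, rfl⟩
      rw [coe_mul, hM]
      ext i j
      simp only [Matrix.add_apply, Matrix.smul_apply, Matrix.mul_apply,
      Fin.sum_univ_two]
      fin_cases i <;> fin_cases j <;> simp <;> ring
    have h01 := (hall _ hmem).1
    simp only [map_apply, Matrix.add_apply, Matrix.smul_apply, Matrix.mul_apply,
      Fin.sum_univ_two] at h01
    simp [hx] at h01
    have htr : φ (M t 0 0) + φ (M t 1 1) - φ t * φ (M t 1 0) = 0 := by
      by_contra hne
      have hdet := (h t).2
      rw [hM, det_fin_two] at hdet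
      simp at hdet
      have hu : IsUnit (M t 0 0 + M t 1 1 - t * M t 1 0 +
          2 * (M t 0 0 * M t 1 1 - M t 0 1 * M t 1 0)) := by
        refine isUnit_of_map_unit φ _ (isUnit_iff_ne_zero.2 ?_)
        simpa [hx] using hne
      refine h2 (hu.mul_left_eq_zero.1 ?_)
      linear_combination hdet
    refine mul_left_cancel₀ ht ?_
    grind
  obtain ⟨t, rfl⟩ := hφ s
  -- Additivity gives `(s + 1)⁻¹ = s⁻¹ + 1`, that is `s² + s + 1 = 0`. In `𝔽₄` this holds for every
  -- `s ≠ 0, 1`.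
  have e1 := hmul 1 (by simp)
  have e2 := hmul t hs0
  have e3 := hmul (t + 1) (by rw [map_add, map_one]; grind)
  rw [hadd] at e3
  simp at e1 e3
  grind

end

/-! ### Induction on the powers of x -/

variable [Finite k] [CharP k 2] {φ : A →+* k} [IsLocalHom φ]
  {H : Subgroup (SpecialLinearGroup (Fin 2) A)}

/-- If `2 ∈ (x ^ 2)` and `H` is onto modulo `x ^ 2`, then it is onto modulo all powers of `x`. -/
theorem surjMod_pow_of_sq (hφ : Function.Surjective φ) {x : A}
    (hker : RingHom.ker φ = Ideal.span {x}) {s : k} (hs0 : s ≠ 0) (hs1 : s ≠ 1)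
    (h2 : (2 : A) ∈ Ideal.span {x ^ 2}) (hsurj : SurjMod H (Ideal.span {x ^ 2})) (n : ℕ) :
    SurjMod H (Ideal.span {x ^ (n + 2)}) := by
  have hx : φ x = 0 := by
    rw [← RingHom.mem_ker, hker]
    exact Ideal.mem_span_singleton_self x
  obtain ⟨δ, hδ⟩ := Ideal.mem_span_singleton.1 h2
  induction n with
  | zero => exact hsurj
  | succ n ih =>
    refine SurjMod.succ hx (Nat.succ_ne_zero (n + 1)) hφ hker hs0 hs1 ih fun hn ↦ ?_
    cases n with
    | zero => exact exists_nonscalar_of_eq_two hx hφ hs0 hs1 hδ ih hn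
    | succ n => exact exists_nonscalar_of_three_le hx hδ ih

/-- If `2` generates the kernel of `φ`, if the residue field has more than four elements
and if `H` is onto modulo `2`, then it is onto modulo all powers of `2`. -/
theorem surjMod_two_pow (hφ : Function.Surjective φ)
    (hker : RingHom.ker φ = Ideal.span {2}) {s : k} (hs0 : s ≠ 0) (hs1 : s ≠ 1)
    (hs : s ^ 2 + s + 1 ≠ 0) (hsurj : SurjMod H (Ideal.span {2})) (n : ℕ) :
    SurjMod H (Ideal.span {2 ^ (n + 1)}) := by
  have hx : φ 2 = 0 := by
    rw [map_ofNat, CharTwo.two_eq_zero]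
  induction n with
  | zero => simpa using hsurj
  | succ n ih =>
    refine SurjMod.succ hx (Nat.succ_ne_zero n) hφ hker hs0 hs1 ih fun hn ↦ ?_
    cases n with
    | zero => exact exists_nonscalar_of_eq_one hx hφ hs0 hs1 hs hsurj (by simpa using hn)
    | succ n => exact exists_nonscalar_of_two_le hx ih

end

/-! ### Choosing s in the residue field -/

lemma exists_sq_add_add_one_ne_zero {k : Type*} [Field k] [Finite k] (hcard : 4 < Nat.card k) :
    ∃ s : k, s ≠ 0 ∧ s ≠ 1 ∧ s ^ 2 + s + 1 ≠ 0 := by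
  classical
  cases nonempty_fintype k
  by_contra! h
  open Polynomial in
  have hp : (X * (X - 1) * (X ^ 2 + X + 1) : k[X]).natDegree = 4 := by compute_degree!
  have hroot : ∀ s : k, s ∈ (X * (X - 1) * (X ^ 2 + X + 1) : Polynomial k).roots := by
    intro s
    rw [Polynomial.mem_roots (Polynomial.ne_zero_of_natDegree_gt (n := 3) (by omega))]
    by_cases h0 : s = 0
    · simp [h0]
    · by_cases h1 : s = 1
      · simp [h1]
      · simp [h s h0 h1]
  have := Multiset.toFinset_card_le (X * (X - 1) * (X ^ 2 + X + 1) : Polynomial k).roots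
  rw [Finset.eq_univ_of_forall fun s ↦ Multiset.mem_toFinset.2 (hroot s), Finset.card_univ,
    ← Nat.card_eq_fintype_card] at this
  have := this.trans (Polynomial.card_roots' _)
  omega

lemma four_lt_card {k : Type*} [Field k] [Finite k] [CharP k 2] (h2 : Nat.card k ≠ 2)
    (h4 : Nat.card k ≠ 4) : 4 < Nat.card k := by
  cases nonempty_fintype k
  obtain ⟨n, -, hn⟩ := FiniteField.card k 2
  rw [← Nat.card_eq_fintype_card] at hn
  have hn0 := n.pos
  have h : 3 ≤ (n : ℕ) := by
    by_contra h
    have : (n : ℕ) = 1 ∨ (n : ℕ) = 2 := by omega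
    rcases this with e | e <;> rw [e] at hn <;> omega
  have := Nat.pow_le_pow_right two_pos h
  omega

lemma exists_ne_zero_ne_one {k : Type*} [Field k] [Finite k] (h2 : Nat.card k ≠ 2) :
    ∃ s : k, s ≠ 0 ∧ s ≠ 1 := by
  classical
  cases nonempty_fintype k
  by_contra! h
  refine h2 ?_
  rw [Nat.card_eq_fintype_card, ← Finset.card_univ, ← Finset.card_pair (zero_ne_one (α := k))]
  congr 1
  ext s
  have := h s
  simp
  tauto

/-! ### Passage to Artinian quotients -/

lemma SurjMod.of_map {R : Type*} [CommRing R]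
    {H : Subgroup (SpecialLinearGroup (Fin 2) R)} {I : Ideal R}
    (h : SurjMod (H.map (SpecialLinearGroup.map (Ideal.Quotient.mk I))) ⊥) : SurjMod H I := by
  intro g
  obtain ⟨_, ⟨a, ha, rfl⟩, hag⟩ := h (SpecialLinearGroup.map (Ideal.Quotient.mk I) g)
  refine ⟨a, ha, fun i j ↦ ?_⟩
  rw [← Ideal.Quotient.eq_zero_iff_mem, map_sub]
  exact hag i j

lemma surjMod_of_map_eq_top {R : Type*} [CommRing R]
    {H : Subgroup (SpecialLinearGroup (Fin 2) R)} {J : Ideal R}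
    (h : H.map (SpecialLinearGroup.map (n := Fin 2) (Ideal.Quotient.mk J)) = ⊤) :
    SurjMod H J := by
  intro g
  obtain ⟨a, ha, hag⟩ := h.ge (Subgroup.mem_top (SpecialLinearGroup.map (Ideal.Quotient.mk J) g))
  refine ⟨a, ha, fun i j ↦ ?_⟩
  rw [← Ideal.Quotient.mk_eq_mk_iff_sub_mem]
  exact congrFun (congrFun (congrArg Subtype.val hag) i) j

section

variable {R : Type*} [CommRing R] [IsLocalRing R]

lemma maximalIdeal_le_span_sup_sq
    (hdim : Module.finrank (ResidueField R) (CotangentSpace R) = 1) {x : R}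
    (hx : x ∈ maximalIdeal R) (hx2 : x ∉ maximalIdeal R ^ 2) :
    maximalIdeal R ≤ Ideal.span {x} ⊔ maximalIdeal R ^ 2 := by
  intro y hy
  have hne : (maximalIdeal R).toCotangent ⟨x, hx⟩ ≠ 0 := by
    rwa [Ne, Ideal.toCotangent_eq_zero]
  obtain ⟨c, hc⟩ := (finrank_eq_one_iff_of_nonzero' (K := ResidueField R) (V := CotangentSpace R)
    _ hne).1 hdim ((maximalIdeal R).toCotangent ⟨y, hy⟩)
  obtain ⟨c, rfl⟩ := residue_surjective c
  have e : (maximalIdeal R).toCotangent (c • ⟨x, hx⟩) = (maximalIdeal R).toCotangent ⟨y, hy⟩ := by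
    rw [map_smul]
    exact hc
  rw [Ideal.toCotangent_eq] at e
  refine Submodule.mem_sup.2 ⟨c * x, Ideal.mul_mem_left _ _ (Ideal.mem_span_singleton_self x),
    y - c * x, ?_, by ring⟩
  rw [← neg_sub]
  exact neg_mem e

lemma exists_mem_maximalIdeal_notMem_sq
    (hdim : Module.finrank (ResidueField R) (CotangentSpace R) = 1) :
    ∃ x ∈ maximalIdeal R, x ∉ maximalIdeal R ^ 2 := by
  have : Nontrivial (CotangentSpace R) := Module.nontrivial_of_finrank_eq_succ hdim
  obtain ⟨v, hv⟩ := exists_ne (0 : CotangentSpace R)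
  obtain ⟨x, rfl⟩ := (maximalIdeal R).toCotangent_surjective v
  exact ⟨x, x.2, fun h ↦ hv ((Ideal.toCotangent_eq_zero _ _).2 h)⟩

lemma map_mk_surjective {I : Ideal R} (hI : I ≠ ⊤) :
    Function.Surjective (SpecialLinearGroup.map (n := Fin 2) (Ideal.Quotient.mk I)) := by
  intro g
  choose f hf using fun i j ↦ Ideal.Quotient.mk_surjective (g.1 i j)
  have hdet : Ideal.Quotient.mk I (f 0 0 * f 1 1 - f 0 1 * f 1 0) = 1 := by
    simp only [map_sub, map_mul, hf]
    rw [← det_fin_two]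
    exact g.2
  have hu : IsUnit (f 0 0 * f 1 1 - f 0 1 * f 1 0) := by
    by_contra h
    have hmem : 1 - (f 0 0 * f 1 1 - f 0 1 * f 1 0) ∈ maximalIdeal R :=
      le_maximalIdeal hI (by rw [← Ideal.Quotient.eq_zero_iff_mem, map_sub, map_one, hdet, sub_self])
    exact (Ideal.ne_top_iff_one _).1 (maximalIdeal.isMaximal R).ne_top
      (by simpa using add_mem hmem ((mem_maximalIdeal _).2 h))
  obtain ⟨v, hv⟩ := hu.exists_right_inv
  have hmkv : Ideal.Quotient.mk I v = 1 := by
    simpa [hdet] using congrArg (Ideal.Quotient.mk I) hv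
  -- The lifted determinant is a unit congruent to 1, so dividing one row by it corrects the
  -- determinant without changing the reduction.
  refine ⟨⟨!![f 0 0 * v, f 0 1 * v; f 1 0, f 1 1], ?_⟩, ?_⟩
  · rw [det_fin_two_of]
    linear_combination hv
  · apply Subtype.ext
    ext i j
    rw [← hf i j]
    change Ideal.Quotient.mk I (!![f 0 0 * v, f 0 1 * v; f 1 0, f 1 1] i j) = _
    fin_cases i <;> fin_cases j <;> simp [hmkv]

lemma SurjMod.map {H : Subgroup (SpecialLinearGroup (Fin 2) R)} {I J : Ideal R} (hI : I ≠ ⊤)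
    (h : SurjMod H J) :
    SurjMod (H.map (SpecialLinearGroup.map (Ideal.Quotient.mk I)))
      (J.map (Ideal.Quotient.mk I)) := by
  intro g
  obtain ⟨g, rfl⟩ := map_mk_surjective hI g
  obtain ⟨a, ha, hag⟩ := h g
  refine ⟨_, Subgroup.mem_map_of_mem _ ha, fun i j ↦ ?_⟩
  have := Ideal.mem_map_of_mem (Ideal.Quotient.mk I) (hag i j)
  rwa [map_sub] at this

/-- The reduction of a proper quotient of a local ring to the residue field of that ring. -/
noncomputable def quotientToResidue {I : Ideal R} (hI : I ≠ ⊤) : R ⧸ I →+* ResidueField R :=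
  Ideal.Quotient.lift I (residue R) fun a ha ↦ (residue_eq_zero_iff a).2 (le_maximalIdeal hI ha)

lemma quotientToResidue_surjective {I : Ideal R} (hI : I ≠ ⊤) :
    Function.Surjective (quotientToResidue hI) := fun a ↦
  let ⟨b, hb⟩ := residue_surjective a
  ⟨Ideal.Quotient.mk I b, hb⟩

instance isLocalHom_quotientToResidue {I : Ideal R} (hI : I ≠ ⊤) :
    IsLocalHom (quotientToResidue hI) where
  map_nonunit a ha := by
    obtain ⟨a, rfl⟩ := Ideal.Quotient.mk_surjective a
    exact (isUnit_of_map_unit (residue R) a ha).map _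

lemma ker_quotientToResidue {I : Ideal R} (hI : I ≠ ⊤) :
    RingHom.ker (quotientToResidue hI) = (maximalIdeal R).map (Ideal.Quotient.mk I) := by
  refine le_antisymm (fun a ha ↦ ?_) (Ideal.map_le_iff_le_comap.2 fun a ha ↦ ?_)
  · obtain ⟨a, rfl⟩ := Ideal.Quotient.mk_surjective a
    exact Ideal.mem_map_of_mem _ ((residue_eq_zero_iff a).1 ha)
  · exact (residue_eq_zero_iff a).2 ha

lemma ker_quotientToResidue_le_jacobson {I : Ideal R} (hI : I ≠ ⊤) :
    RingHom.ker (quotientToResidue hI) ≤ (⊥ : Ideal (R ⧸ I)).jacobson := fun a ha ↦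
  Ideal.mem_jacobson_bot.2 fun b ↦
    isUnit_of_map_unit (quotientToResidue hI) _ (by simp [(RingHom.mem_ker).1 ha])

lemma ker_quotientToResidue_eq_span {I : Ideal R} (hI : I ≠ ⊤) [IsArtinianRing (R ⧸ I)] {x : R}
    (hx : x ∈ maximalIdeal R) (hspan : maximalIdeal R ≤ Ideal.span {x} ⊔ maximalIdeal R ^ 2) :
    RingHom.ker (quotientToResidue hI) = Ideal.span {Ideal.Quotient.mk I x} := by
  refine le_antisymm ?_ ?_
  · refine Submodule.le_of_le_smul_of_le_jacobson_bot (IsNoetherian.noetherian _)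
      (ker_quotientToResidue_le_jacobson hI) ?_
    have := Ideal.map_mono (f := Ideal.Quotient.mk I) hspan
    rwa [Ideal.map_sup, Ideal.map_pow, Ideal.map_span, Set.image_singleton,
      ← ker_quotientToResidue hI, sq] at this
  · rw [Ideal.span_singleton_le_iff_mem]
    exact (residue_eq_zero_iff x).2 hx

lemma exists_pow_mk_eq_zero {I : Ideal R} (hI : I ≠ ⊤) [IsArtinianRing (R ⧸ I)] {x : R}
    (hx : x ∈ maximalIdeal R) : ∃ n, Ideal.Quotient.mk I x ^ n = 0 := by
  obtain ⟨n, hn⟩ := IsArtinianRing.isNilpotent_jacobson_bot (R := R ⧸ I)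
  refine ⟨n, ?_⟩
  have := Ideal.pow_mem_pow (ker_quotientToResidue_le_jacobson hI
    ((residue_eq_zero_iff x).2 hx : Ideal.Quotient.mk I x ∈ _)) n
  rwa [hn] at this

/-- Let the maximal ideal of `R` be principal modulo its square.  A subgroup of `SL₂(R)` that is
onto modulo `(2, 𝔪 ^ 2)` is onto modulo every ideal with Artinian quotient. -/
theorem surjMod_of_isArtinianRing_quotient [Finite (ResidueField R)] [CharP (ResidueField R) 2]
    (hcard : Nat.card (ResidueField R) ≠ 2)
    (hdim : Module.finrank (ResidueField R) (CotangentSpace R) = 1)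
    (h4 : Nat.card (ResidueField R) = 4 → (2 : R) ∈ maximalIdeal R ^ 2)
    {H : Subgroup (SpecialLinearGroup (Fin 2) R)}
    (hsurj : SurjMod H (Ideal.span {2} ⊔ maximalIdeal R ^ 2))
    (I : Ideal R) [IsArtinianRing (R ⧸ I)] : SurjMod H I := by
  by_cases hI : I = ⊤
  · subst hI
    exact fun g ↦ ⟨1, H.one_mem, fun i j ↦ Submodule.mem_top⟩
  apply SurjMod.of_map
  have h2 : (2 : R) ∈ maximalIdeal R := by
    rw [← residue_eq_zero_iff, map_ofNat, CharTwo.two_eq_zero]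
  by_cases h22 : (2 : R) ∈ maximalIdeal R ^ 2
  · obtain ⟨x, hx, hx2⟩ := exists_mem_maximalIdeal_notMem_sq hdim
    have hker := ker_quotientToResidue_eq_span hI hx (maximalIdeal_le_span_sup_sq hdim hx hx2)
    have hsq : (maximalIdeal R ^ 2).map (Ideal.Quotient.mk I) =
        Ideal.span {Ideal.Quotient.mk I x ^ 2} := by
      rw [Ideal.map_pow, ← ker_quotientToResidue hI, hker, Ideal.span_singleton_pow]
    obtain ⟨s, hs0, hs1⟩ := exists_ne_zero_ne_one hcard
    obtain ⟨n, hn⟩ := exists_pow_mk_eq_zero hI hx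
    rw [sup_eq_right.2 ((Ideal.span_singleton_le_iff_mem _).2 h22)] at hsurj
    have hsurj' := hsurj.map hI
    rw [hsq] at hsurj'
    refine (surjMod_pow_of_sq (quotientToResidue_surjective hI) hker hs0 hs1 ?_ hsurj' n).mono ?_
    · rw [← hsq, ← map_ofNat (Ideal.Quotient.mk I) 2]
      exact Ideal.mem_map_of_mem _ h22
    · simp [pow_add, hn]
  · have hker := ker_quotientToResidue_eq_span hI h2 (maximalIdeal_le_span_sup_sq hdim h2 h22)
    rw [map_ofNat] at hker
    obtain ⟨s, hs0, hs1, hs⟩ :=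
      exists_sq_add_add_one_ne_zero (four_lt_card hcard fun h ↦ h22 (h4 h))
    obtain ⟨n, hn⟩ := exists_pow_mk_eq_zero hI h2
    -- Here `2` generates the maximal ideal of the quotient, and surjectivity modulo `𝔪` suffices to
    -- start.
    have hsurj' := (hsurj.mono (sup_le ((Ideal.span_singleton_le_iff_mem _).2 h2)
      (Ideal.pow_le_self two_ne_zero))).map hI
    rw [← ker_quotientToResidue hI, hker] at hsurj'
    refine (surjMod_two_pow (quotientToResidue_surjective hI) hker hs0 hs1 hs hsurj' n).mono ?_
    rw [map_ofNat] at hn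
    simp [pow_add, hn]

end

/-! ### Closed subgroups and the residue field -/

/-- A closed subgroup of `SL₂(R)` that is onto modulo all open ideals is everything. -/
theorem eq_top_of_isClosed {R : Type*} [CommRing R] [TopologicalSpace R] [IsTopologicalRing R]
    [IsLinearTopology R R] {H : Subgroup (SpecialLinearGroup (Fin 2) R)}
    (hclosed : IsClosed (H : Set (SpecialLinearGroup (Fin 2) R)))
    (hsurj : ∀ I : Ideal R, IsOpen (I : Set R) → SurjMod H I) : H = ⊤ := by
  rw [eq_top_iff]
  intro g _
  rw [← SetLike.mem_coe, ← hclosed.closure_eq, mem_closure_iff]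
  intro U hU hgU
  obtain ⟨V, hV, rfl⟩ := isOpen_induced_iff.1 hU
  have hex : ∃ I : Ideal R, IsOpen (I : Set R) ∧
      ∀ M : Matrix (Fin 2) (Fin 2) R, (∀ i j, M i j - g.1 i j ∈ I) → M ∈ V := by
    obtain ⟨u, hu, huU⟩ := (isOpen_pi_iff' (A := fun _ : Fin 2 ↦ Fin 2 → R)).1 hV g.1 hgU
    choose w hw hwu using fun i ↦ isOpen_pi_iff'.1 (hu i).1 (g.1 i) (hu i).2
    have hI : ∀ i j, ∃ I : Ideal R, IsOpen (I : Set R) ∧ ∀ a, a - g.1 i j ∈ I → a ∈ w i j := by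
      intro i j
      have hmem : (fun a ↦ a + g.1 i j) ⁻¹' w i j ∈ nhds 0 :=
        (continuous_id.add continuous_const).continuousAt.preimage_mem_nhds
          ((hw i j).1.mem_nhds (by simpa using (hw i j).2))
      obtain ⟨I, hI, hIw⟩ := IsLinearTopology.hasBasis_open_ideal.mem_iff.1 hmem
      exact ⟨I, hI, fun a ha ↦ by simpa using hIw ha⟩
    choose I hI hIw using hI
    refine ⟨⨅ i, ⨅ j, I i j, ?_, fun M hM ↦ huU fun i _ ↦ hwu i fun j _ ↦ hIw i j _ ?_⟩
    · simp only [Submodule.coe_iInf]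
      exact isOpen_iInter_of_finite fun i ↦ isOpen_iInter_of_finite fun j ↦ hI i j
    · exact (iInf_le_of_le i (iInf_le _ j) : ⨅ i, ⨅ j, I i j ≤ I i j) (hM i j)
  obtain ⟨I, hI, hIU⟩ := hex
  obtain ⟨a, ha, hag⟩ := hsurj I hI g
  exact ⟨a, hIU _ hag, ha⟩

/-- A field that is a quotient of `W(F)` is isomorphic to `F`. -/
lemma nonempty_ringEquiv_residueField (p : ℕ) [Fact p.Prime] {F : Type*} [Field F] [CharP F p]
    [PerfectRing F p] {k : Type*} [Field k] {f : WittVector p F →+* k}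
    (hf : Function.Surjective f) : Nonempty (F ≃+* k) := by
  have hc : Function.Surjective (WittVector.constantCoeff : WittVector p F →+* F) := fun a ↦
    ⟨WittVector.teichmuller p a, WittVector.teichmuller_coeff_zero p a⟩
  have e : RingHom.ker (WittVector.constantCoeff : WittVector p F →+* F) = RingHom.ker f := by
    rw [eq_maximalIdeal (RingHom.ker_isMaximal_of_surjective _ hc),
      eq_maximalIdeal (RingHom.ker_isMaximal_of_surjective _ hf)]
  exact ⟨(RingHom.quotientKerEquivOfSurjective hc).symm.trans
    ((Ideal.quotEquivOfEq e).trans (RingHom.quotientKerEquivOfSurjective hf))⟩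

end SL2Lift


theorem proposition5 (F : Type*) [Field F] [Finite F] [CharP F 2] (hF : Nat.card F ≠ 2)
    (R : Type*) [CommRing R] [IsLocalRing R] [Algebra (WittVector 2 F) R] [UniformSpace R]
    [IsProArtinLocal 2 F R]
    (hdim : Module.finrank (IsLocalRing.ResidueField R) (IsLocalRing.CotangentSpace R) = 1)
    (hF4 : Nat.card F = 4 → (2 : R) ∈ IsLocalRing.maximalIdeal R ^ 2)
    (H : Subgroup (Matrix.SpecialLinearGroup (Fin 2) R))
    (hclosed : IsClosed (H : Set (Matrix.SpecialLinearGroup (Fin 2) R)))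
    (hsurj : H.map (Matrix.SpecialLinearGroup.map (n := Fin 2)
      (Ideal.Quotient.mk (Ideal.span {(2 : R)} ⊔ IsLocalRing.maximalIdeal R ^ 2))) = ⊤) :
    H = ⊤ := by
  obtain ⟨e⟩ := SL2Lift.nonempty_ringEquiv_residueField 2
    (IsProArtinLocal.residue_surjective (p := 2) (F := F) (R := R))
  have hcard := Nat.card_congr e.toEquiv
  have : Finite (IsLocalRing.ResidueField R) := Finite.of_equiv _ e.toEquiv
  have : CharP (IsLocalRing.ResidueField R) 2 :=
    charP_of_injective_ringHom (f := (e : F →+* _)) e.injective 2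
  have := IsProArtinLocal.isTopologicalRing 2 F (R := R)
  have := IsProArtinLocal.isLinearTopology 2 F (R := R)
  refine SL2Lift.eq_top_of_isClosed hclosed fun I hI ↦ ?_
  have := IsProArtinLocal.isArtinianRing_quotient 2 F I hI
  exact SL2Lift.surjMod_of_isArtinianRing_quotient (hcard ▸ hF) hdim (hcard ▸ hF4)
    (SL2Lift.surjMod_of_map_eq_top hsurj) I
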